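/- Let $K$ be a real closed (that is, maximal) ordered field, Archimedean or non-Archimedean, which is Cauchy complete and whose order topology has a countable basis of neighbourhoods of $0$. Let $S(X)=\sum_{i\ge 0}a_iX^i$ be a power series over $K$, let $S_n(X)=\sum_{i=0}^n a_iX^i$ be its partial sums, and let $a<b$ in $K$ be such that $S$ converges at every point of $[a,b]$, i.e. $S(x)=\lim_{n\to\infty}S_n(x)$ exists in $K$ for all $x\in[a,b]$. Put $Z_n=\{z\in[a,b] : S_n(z)=0\}$ and $Z=\bigcup_{n\ge 0}Z_n$. If $S(a)S(b)<0$, then there is a zero $c\in[a,b]$ of $S$ at which the zeros of the partial sums accumulate, in the following sense: every neighbourhood of $c$ contains a point of $Z_n$ for all sufficiently large $n$ and, if $S$ is not a polynomial, every neighbourhood of $c$ contains a point of $Z$ different from $c$. Moreover, $c$ is the limit of a sequence $(z_n)$ with $z_n\in Z_n$, that is $z_n\in[a,b]$ and $S_n(z_n)=0$, for all sufficiently large $n$. -/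

import Mathlib

open Filter Topology Set

namespace OrderedPowerSeries

/-- The `n`-th partial sum `S_n(X) = ∑_{i = 0}^n a_i X^i` of `S(X) = ∑ a_i X^i`, a polynomial. -/
noncomputable def partialSum {K : Type*} [Field K] (S : PowerSeries K) (n : ℕ) : Polynomial K :=
  S.trunc (n + 1)

/-- `S(X)` converges at `x`: the sequence of the values `S_n(x)` has a limit in `K`. -/
def ConvergesAt {K : Type*} [Field K] [TopologicalSpace K] (S : PowerSeries K) (x : K) : Prop :=
  ∃ s : K, Tendsto (fun n : ℕ => (partialSum S n).eval x) atTop (𝓝 s)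

/-- The value `S(x) = lim S_n(x)`; it is meaningful where `S(X)` converges. -/
noncomputable def value {K : Type*} [Field K] [TopologicalSpace K] (S : PowerSeries K) (x : K) :
    K :=
  limUnder atTop (fun n : ℕ => (partialSum S n).eval x)

/-- The set `Z_n` of the zeros in `[a, b]` of the partial sum `S_n(X)`. -/
def partialZeros {K : Type*} [Field K] [LinearOrder K] (S : PowerSeries K) (a b : K) (n : ℕ) :
    Set K :=
  {z | z ∈ Icc a b ∧ (partialSum S n).eval z = 0}

end OrderedPowerSeries

/-! Up to replacing `S` by `-S`, let `S(a) < 0 < S(b)`. Abel's inequality, applied at `a` and at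
`b`, makes `S_n → S` uniform on `[a, b]`. Suppose every sign change of `S` persists in arbitrarily
short subintervals (`SignChangeRefinable`). A countable basis at `0` gives a positive null sequence,
hence nested sign changes with lengths tending to `0`, and Cauchy completeness gives their common
point `c`. A uniform limit of polynomials is continuous, so `S(c) = 0`; for large `n` the polynomial
`S_n` has the signs of `S` at the ends of any fixed interval of the nest, so the intermediate value
theorem for polynomials over real closed fields puts a zero of `S_n` there.

Refinability is the heart, since bisection does not shrink lengths to `0` over a non-Archimedean
field. If `K` is Archimedean, embed it in `ℝ`: by the identity theorem `S` is nonzero somewhere in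
each middle third, and cutting there works. Otherwise some term `a_d r^d` exceeds every integer
multiple of each later term. The `d`-th differences of `S_n` are then controlled by that term, so
`S_n` cannot stay within a small `η` of zero on an interval of length `ε`. Hence an interval on
which `S_n` crosses the strip from `-η` to `η` is shorter than `ε`, and `S` changes sign on it. -/

/-! ### Intermediate values of polynomials over a real closed field -/

open Polynomial in
theorem Polynomial.exists_isRoot_of_natDegree_eq_two_of_isSquare {k : Type*} [Field k]
    [NeZero (2 : k)] {q : k[X]} (hq : q.natDegree = 2)
    (hs : IsSquare (discrim (q.coeff 2) (q.coeff 1) (q.coeff 0))) : ∃ x, q.IsRoot x := by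
  have h2 : q.coeff 2 ≠ 0 := by
    rw [← hq]; exact leadingCoeff_ne_zero.2 (fun h => by simp [h] at hq)
  obtain ⟨s, hs⟩ := hs
  obtain ⟨x, hx⟩ := exists_quadratic_eq_zero h2 ⟨s, hs⟩
  refine ⟨x, ?_⟩
  rw [IsRoot, eval_eq_sum_range, hq]
  simp only [Finset.sum_range_succ, Finset.sum_range_zero]
  linear_combination hx

open Polynomial in
theorem finrank_ne_two_of_forall_isSquare {k F : Type*} [Field k] [NeZero (2 : k)]
    (hk : ∀ x : k, IsSquare x) [Field F] [Algebra k F] : Module.finrank k F ≠ 2 := by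
  intro h
  have : FiniteDimensional k F := Module.finite_of_finrank_eq_succ h
  have hmem : ∀ z : F, z ∈ (⊥ : Subalgebra k F) := by
    intro z
    have hint : IsIntegral k z := Algebra.IsIntegral.isIntegral z
    have hle := minpoly.natDegree_le (A := k) z
    rw [h] at hle
    have hpos := minpoly.natDegree_pos hint
    have hone : (minpoly k z).natDegree = 1 := by
      by_contra h1
      obtain ⟨x, hx⟩ := exists_isRoot_of_natDegree_eq_two_of_isSquare
        (show (minpoly k z).natDegree = 2 by omega) (hk _)
      exact h1 (natDegree_eq_of_degree_eq_some
        (degree_eq_one_of_irreducible_of_root (minpoly.irreducible hint) hx))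
    exact Algebra.mem_bot.2 (minpoly.natDegree_eq_one_iff.1 hone)
  have := Subalgebra.bot_eq_top_iff_finrank_eq_one.1 (eq_top_iff.2 fun z _ => hmem z)
  omega

namespace IsRealClosed

variable {R : Type*} [Field R] [IsRealClosed R] [LinearOrder R] [IsStrictOrderedRing R]

open Polynomial in
omit [LinearOrder R] [IsStrictOrderedRing R] in
theorem natDegree_eq_one_of_irreducible_of_odd {p : R[X]} (hp : Irreducible p)
    (h : Odd p.natDegree) : p.natDegree = 1 := by
  obtain ⟨x, hx⟩ := exists_isRoot_of_odd_natDegree h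
  exact natDegree_eq_of_degree_eq_some (degree_eq_one_of_irreducible_of_root hp hx)

theorem finrank_eq_one_of_odd {F : Type*} [Field F] [Algebra R F] [FiniteDimensional R F]
    (h : Odd (Module.finrank R F)) : Module.finrank R F = 1 := by
  obtain ⟨α, hα⟩ := Field.exists_primitive_element R F
  have hint : IsIntegral R α := Algebra.IsIntegral.isIntegral α
  have hd := (Field.primitive_element_iff_minpoly_natDegree_eq R α).1 hα
  rw [← hd] at h ⊢
  exact natDegree_eq_one_of_irreducible_of_odd (minpoly.irreducible hint) h

/-- The fixed field of a Sylow 2-subgroup has odd degree over `R`, hence is `R`. -/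
theorem finrank_eq_two_pow {L : Type*} [Field L] [Algebra R L] [FiniteDimensional R L]
    [IsGalois R L] : ∃ m, Module.finrank R L = 2 ^ m := by
  have : Fact (Nat.Prime 2) := ⟨Nat.prime_two⟩
  obtain ⟨H⟩ : Nonempty (Sylow 2 Gal(L/R)) := inferInstance
  have hodd : ¬ 2 ∣ (H : Subgroup Gal(L/R)).index := H.not_dvd_index
  have hmul := Module.finrank_mul_finrank R (IntermediateField.fixedField (H : Subgroup Gal(L/R))) L
  rw [IntermediateField.finrank_fixedField_eq_card] at hmul
  have hcard : Nat.card Gal(L/R) = Module.finrank R L := IsGalois.card_aut_eq_finrank R L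
  have hidx := (H : Subgroup Gal(L/R)).index_mul_card
  rw [hcard, ← hmul] at hidx
  have hidx := Nat.eq_of_mul_eq_mul_right Nat.card_pos hidx
  rw [hidx] at hodd
  rw [finrank_eq_one_of_odd (Nat.odd_iff.2 (by omega)), one_mul] at hmul
  obtain ⟨m, hm⟩ := IsPGroup.iff_card.1 H.2
  exact ⟨m, hmul.symm.trans hm⟩

/-- The classical root `u ± iv`, with `u² = (ρ + x)/2`, `v² = (ρ - x)/2` and `ρ² = x² + y²`. -/
theorem isSquare_add_mul {A : Type*} [CommRing A] [Algebra R A] {i : A} (hi : i ^ 2 = -1)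
    (x y : R) : IsSquare (algebraMap R A x + i * algebraMap R A y) := by
  obtain ⟨ρ, hρ⟩ := exists_eq_pow_of_nonneg (show 0 ≤ x ^ 2 + y ^ 2 by positivity) two_ne_zero
  wlog hpos : 0 ≤ ρ generalizing ρ
  · exact this (-ρ) (by rw [hρ]; ring) (by linarith)
  have h1 : |x| ≤ ρ := abs_le_of_sq_le_sq (by nlinarith [sq_nonneg y]) hpos
  rw [abs_le] at h1
  obtain ⟨u, hu⟩ := exists_eq_pow_of_nonneg (show 0 ≤ (ρ + x) / 2 by linarith) two_ne_zero
  obtain ⟨v, hv⟩ := exists_eq_pow_of_nonneg (show 0 ≤ (ρ - x) / 2 by linarith) two_ne_zero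
  have huv : (2 * u * v) ^ 2 = y ^ 2 := by
    calc (2 * u * v) ^ 2 = 4 * u ^ 2 * v ^ 2 := by ring
      _ = ρ ^ 2 - x ^ 2 := by rw [← hu, ← hv]; ring
      _ = y ^ 2 := by rw [← hρ]; ring
  have hx : x = u ^ 2 - v ^ 2 := by rw [← hu, ← hv]; ring
  rcases sq_eq_sq_iff_eq_or_eq_neg.1 huv with h | h
  · refine ⟨algebraMap R A u + i * algebraMap R A v, ?_⟩
    rw [← h, hx]
    simp only [map_sub, map_mul, map_pow, map_ofNat]
    linear_combination -(algebraMap R A v) ^ 2 * hi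
  · refine ⟨algebraMap R A u - i * algebraMap R A v, ?_⟩
    rw [show y = -(2 * u * v) by rw [h, neg_neg], hx]
    simp only [map_sub, map_mul, map_pow, map_ofNat, map_neg]
    linear_combination -(algebraMap R A v) ^ 2 * hi

-- `[L : R(i)]` is a power of 2. If it is not 1, a subgroup of index 2 yields a quadratic extension
-- of `R(i)`, where every element is already a square.
open IntermediateField in
theorem finrank_le_two {L : Type*} [Field L] [Algebra R L] [FiniteDimensional R L]
    [IsGalois R L] {i : L} (hi : i ^ 2 = -1) : Module.finrank R L ≤ 2 := by
  have : Fact (Nat.Prime 2) := ⟨Nat.prime_two⟩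
  have hint : IsIntegral R i := Algebra.IsIntegral.isIntegral i
  have hroot : Polynomial.aeval i (Polynomial.X ^ 2 + 1 : Polynomial R) = 0 := by simp [hi]
  have hdeg : (Polynomial.X ^ 2 + 1 : Polynomial R).natDegree = 2 := by compute_degree!
  have hne : (Polynomial.X ^ 2 + 1 : Polynomial R) ≠ 0 := fun h => by simp [h] at hdeg
  have hle : (minpoly R i).natDegree ≤ 2 :=
    hdeg ▸ Polynomial.natDegree_le_of_dvd (minpoly.dvd R i hroot) hne
  have hfr := IntermediateField.adjoin.finrank hint
  have : CharZero R⟮i⟯ := algebraRat.charZero _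
  have hsq : ∀ z : R⟮i⟯, IsSquare z := by
    intro z
    let pb := adjoin.powerBasis hint
    obtain ⟨f, hf, hz⟩ := pb.exists_eq_aeval z
    have hf : f.natDegree < 2 := lt_of_lt_of_le hf (by simpa [pb] using hle)
    have hgen : (AdjoinSimple.gen R i) ^ 2 = -1 := by
      apply Subtype.ext; simpa using hi
    have := isSquare_add_mul hgen (f.coeff 0) (f.coeff 1)
    rw [hz, Polynomial.aeval_eq_sum_range' hf]
    simpa [Finset.sum_range_succ, Algebra.smul_def, mul_comm, pb] using this
  obtain ⟨m, hm⟩ := finrank_eq_two_pow (R := R) (L := L)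
  have hmul := Module.finrank_mul_finrank R R⟮i⟯ L
  obtain ⟨j, hj, hjL⟩ := (Nat.dvd_prime_pow Nat.prime_two).1
    (show Module.finrank R⟮i⟯ L ∣ 2 ^ m from hm ▸ Dvd.intro_left _ hmul)
  rcases j with _ | j
  · rw [hjL, pow_zero, mul_one, hfr] at hmul
    omega
  · exfalso
    have hcard : Nat.card Gal(L/R⟮i⟯) = 2 ^ (j + 1) :=
      (IsGalois.card_aut_eq_finrank R⟮i⟯ L).trans hjL
    obtain ⟨H, hH⟩ := Sylow.exists_subgroup_card_pow_prime (G := Gal(L/R⟮i⟯)) 2 (n := j)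
      (by rw [hcard]; exact pow_dvd_pow _ (Nat.le_succ j))
    have h2 := Module.finrank_mul_finrank R⟮i⟯ (fixedField H) L
    rw [finrank_fixedField_eq_card, hH, hjL, pow_succ, mul_comm] at h2
    exact finrank_ne_two_of_forall_isSquare hsq (Nat.eq_of_mul_eq_mul_left (by positivity) h2)

-- The splitting field of `p * (X ^ 2 + 1)` contains both `i` and a root of `p`, so `finrank_le_two`
-- bounds the degree of that root.
open Polynomial in
theorem natDegree_le_two_of_irreducible {p : R[X]} (hp : Irreducible p) : p.natDegree ≤ 2 := by
  set q : R[X] := p * (X ^ 2 + 1) with hq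
  let L := q.SplittingField
  have hne : (X ^ 2 + 1 : R[X]) ≠ 0 := by
    have : (X ^ 2 + 1 : R[X]).natDegree = 2 := by compute_degree!
    rintro h
    simp [h] at this
  have hq0 : q ≠ 0 := mul_ne_zero hp.ne_zero hne
  have : Normal R L := Normal.of_isSplittingField q
  have : IsGalois R L := {}
  have hs : (q.map (algebraMap R L)).Splits := SplittingField.splits q
  have hq0' : q.map (algebraMap R L) ≠ 0 := map_ne_zero hq0
  have key : ∀ g : R[X], g ∣ q → g.degree ≠ 0 → ∃ x : L, aeval x g = 0 := by
    intro g hg hd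
    have := (hs.of_dvd hq0' (Polynomial.map_dvd (algebraMap R L) hg)).exists_eval_eq_zero
      (by rwa [degree_map])
    simpa [eval_map_algebraMap] using this
  obtain ⟨i, hi⟩ := key (X ^ 2 + 1) (Dvd.intro_left _ rfl) (by
    rw [show (X ^ 2 + 1 : R[X]).degree = 2 by compute_degree!]; decide)
  obtain ⟨x, hx⟩ := key p (Dvd.intro _ rfl) hp.degree_pos.ne'
  have h2 := finrank_le_two (R := R) (L := L) (i := i) (by
    simp at hi; linear_combination hi)
  have h3 := minpoly.natDegree_le (A := R) x
  rw [← minpoly.eq_of_irreducible hp hx, natDegree_mul_C (inv_ne_zero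
    (leadingCoeff_ne_zero.2 hp.ne_zero))] at h3
  omega

-- The discriminant is negative, so `4 u p(x) = (2ux + v)² - disc > 0`: all values have the sign of
-- `u`.
open Polynomial in
theorem eval_mul_eval_nonneg_of_irreducible_of_natDegree_eq_two {p : R[X]} (hp : Irreducible p)
    (h : p.natDegree = 2) (x y : R) : 0 ≤ p.eval x * p.eval y := by
  set u := p.coeff 2 with hu
  set v := p.coeff 1 with hv
  set w := p.coeff 0 with hw
  have heval : ∀ x, p.eval x = u * x ^ 2 + v * x + w := by
    intro x
    rw [eval_eq_sum_range, h]
    simp only [Finset.sum_range_succ, Finset.sum_range_zero, ← hu, ← hv, ← hw]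
    ring
  have hu0 : u ≠ 0 := by
    rw [hu, ← h]; exact leadingCoeff_ne_zero.2 hp.ne_zero
  have hdisc : discrim u v w < 0 := by
    by_contra! hd
    obtain ⟨z, hz⟩ := exists_isRoot_of_natDegree_eq_two_of_isSquare h (IsSquare.of_nonneg hd)
    have : p.natDegree = 1 :=
      natDegree_eq_of_degree_eq_some (degree_eq_one_of_irreducible_of_root hp hz)
    omega
  rw [discrim] at hdisc
  have hpos : ∀ x, 0 < u * p.eval x := by
    intro x
    rw [heval]
    nlinarith [sq_nonneg (2 * u * x + v)]
  have h1 := mul_pos (hpos x) (hpos y)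
  have h2 : 0 < u ^ 2 := by positivity
  have h3 : 0 < u ^ 2 * (p.eval x * p.eval y) := by linarith [h1]
  exact (pos_of_mul_pos_right h3 h2.le).le

open Polynomial in
/-- The intermediate value theorem for polynomials over a real closed field. -/
theorem exists_isRoot_mem_Ioo (p : R[X]) {x y : R} (hxy : x < y)
    (h : p.eval x * p.eval y < 0) : ∃ z ∈ Ioo x y, p.IsRoot z := by
  -- Split off an irreducible factor: the sign change occurs in it or in the cofactor, and an
  -- irreducible factor that changes sign is linear.
  induction hn : p.natDegree using Nat.strong_induction_on generalizing p with
  | _ n ih =>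
  subst hn
  have hp0 : p ≠ 0 := by rintro rfl; simp at h
  have hpu : ¬ IsUnit p := by
    intro hu
    obtain ⟨r, -, rfl⟩ := Polynomial.isUnit_iff.1 hu
    simp at h
    nlinarith [mul_self_nonneg r]
  obtain ⟨q, hq, g, rfl⟩ := WfDvdMonoid.exists_irreducible_factor hpu hp0
  have hg0 : g ≠ 0 := right_ne_zero_of_mul hp0
  rw [eval_mul, eval_mul] at h
  by_cases hgs : g.eval x * g.eval y < 0
  · obtain ⟨z, hz, hr⟩ := ih g.natDegree (by
      rw [natDegree_mul hq.ne_zero hg0]; have := hq.natDegree_pos; omega) g hgs rfl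
    exact ⟨z, hz, by rw [IsRoot, eval_mul, hr, mul_zero]⟩
  · have hqs : q.eval x * q.eval y < 0 := by
      by_contra! hc
      nlinarith [mul_nonneg hc (not_lt.1 hgs)]
    have h2 := natDegree_le_two_of_irreducible hq
    have h0 := hq.natDegree_pos
    rcases (show q.natDegree = 1 ∨ q.natDegree = 2 by omega) with h1 | h2
    · obtain ⟨u, hu, v, rfl⟩ := natDegree_eq_one.1 h1
      have hz : (C u * X + C v).eval (-v / u) = 0 := by simp; field_simp; ring
      refine ⟨-v / u, ?_, by rw [IsRoot, eval_mul, hz, zero_mul]⟩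
      simp only [eval_add, eval_mul, eval_C, eval_X] at hqs
      have h3 : 0 < u ^ 2 := by positivity
      have h4 : u ^ 2 * ((x - -v / u) * (y - -v / u)) < 0 := by
        field_simp; linarith
      have h5 : (x - -v / u) * (y - -v / u) < 0 := by
        by_contra! hc; nlinarith
      constructor <;> by_contra! hc <;> nlinarith
    · exact absurd (eval_mul_eval_nonneg_of_irreducible_of_natDegree_eq_two hq h2 x y)
        (not_le.2 hqs)

end IsRealClosed

/-! ### Forward differences of polynomials -/

section ForwardDifference

variable {K : Type*} [Field K]

/-- The discrete Leibniz rule; only two terms remain because second differences of `y` vanish. It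
drives the inductions on the exponent of `y ^ k`. -/
theorem fwdDiff_iter_succ_id_mul (h : K) (f : K → K) (d : ℕ) (x : K) :
    (fwdDiff h)^[d + 1] (fun y => y * f y) x =
      (x + (d + 1) * h) * (fwdDiff h)^[d + 1] f x + (d + 1) * h * (fwdDiff h)^[d] f x := by
  induction d generalizing x with
  | zero => simp [fwdDiff]; ring
  | succ d ih =>
    rw [Function.iterate_succ_apply', fwdDiff, ih, ih,
      Function.iterate_succ_apply' _ (d + 1) f, fwdDiff, Function.iterate_succ_apply' _ d f]
    simp only [fwdDiff]
    push_cast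
    ring

theorem fwdDiff_iter_succ_pow_succ (h : K) (d k : ℕ) (x : K) :
    (fwdDiff h)^[d + 1] (fun y => y ^ (k + 1)) x =
      (x + (d + 1) * h) * (fwdDiff h)^[d + 1] (fun y => y ^ k) x +
        (d + 1) * h * (fwdDiff h)^[d] (fun y => y ^ k) x := by
  simpa only [pow_succ'] using fwdDiff_iter_succ_id_mul h (fun y => y ^ k) d x

theorem fwdDiff_iter_succ_pow_zero (h : K) (d : ℕ) (x : K) :
    (fwdDiff h)^[d + 1] (fun y => y ^ 0) x = 0 := by
  induction d generalizing x with
  | zero => simp [fwdDiff]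
  | succ d ih => rw [Function.iterate_succ_apply', fwdDiff, ih, ih, sub_zero]

theorem fwdDiff_iter_pow_of_lt (h : K) {k d : ℕ} (hkd : k < d) (x : K) :
    (fwdDiff h)^[d] (fun y => y ^ k) x = 0 := by
  induction k generalizing d with
  | zero =>
    obtain ⟨d, rfl⟩ := Nat.exists_eq_succ_of_ne_zero hkd.ne'
    exact fwdDiff_iter_succ_pow_zero h d x
  | succ k ih =>
    obtain ⟨d, rfl⟩ := Nat.exists_eq_succ_of_ne_zero (Nat.ne_zero_of_lt hkd)
    rw [Nat.succ_eq_add_one, fwdDiff_iter_succ_pow_succ, ih (by omega), ih (by omega)]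
    ring

theorem fwdDiff_iter_pow_self (h : K) (d : ℕ) (x : K) :
    (fwdDiff h)^[d] (fun y => y ^ d) x = d.factorial * h ^ d := by
  induction d with
  | zero => simp
  | succ d ih =>
    rw [fwdDiff_iter_succ_pow_succ, ih, fwdDiff_iter_pow_of_lt h (Nat.lt_succ_self d),
      Nat.factorial_succ]
    push_cast
    ring

theorem fwdDiff_iter_sum_mul_pow (h : K) (a : ℕ → K) (s : Finset ℕ) (d : ℕ) (x : K) :
    (fwdDiff h)^[d] (fun y => ∑ k ∈ s, a k * y ^ k) x =
      ∑ k ∈ s, a k * (fwdDiff h)^[d] (fun y => y ^ k) x := by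
  induction d generalizing x with
  | zero => simp
  | succ d ih =>
    simp only [Function.iterate_succ_apply', fwdDiff, ih, mul_sub, Finset.sum_sub_distrib]

variable [LinearOrder K] [IsStrictOrderedRing K]

theorem abs_fwdDiff_iter_le {f : K → K} {h M : K} (d : ℕ) {x : K}
    (hf : ∀ j ≤ d, |f (x + j * h)| ≤ M) : |(fwdDiff h)^[d] f x| ≤ 2 ^ d * M := by
  induction d generalizing x with
  | zero => simpa using hf 0 le_rfl
  | succ d ih =>
    rw [Function.iterate_succ_apply', fwdDiff]
    have h1 := ih (x := x) fun j hj => hf j (by omega)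
    have h2 := ih (x := x + h) fun j hj => by
      have := hf (j + 1) (by omega)
      rwa [show x + ((j + 1 : ℕ) : K) * h = x + h + j * h by push_cast; ring] at this
    rw [abs_le] at *
    constructor <;> rw [pow_succ] <;> linarith

/-- What matters is that `C` is an integer independent of `x`, `h`, `r`: domination by every integer
factor absorbs it. -/
theorem exists_abs_fwdDiff_iter_pow_le (K : Type*) [Field K] [LinearOrder K]
    [IsStrictOrderedRing K] (d k : ℕ) : ∃ C : ℕ, ∀ x h r : K, 0 ≤ h → |x| ≤ r →
      |x + d * h| ≤ r → r ^ d * |(fwdDiff h)^[d] (fun y => y ^ k) x| ≤ C * (h ^ d * r ^ k) := by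
  induction k generalizing d with
  | zero =>
    cases d with
    | zero => exact ⟨1, fun x h r _ _ _ => by simp⟩
    | succ d => exact ⟨0, fun x h r _ _ _ => by rw [fwdDiff_iter_succ_pow_zero]; simp⟩
  | succ k ih =>
    cases d with
    | zero =>
      refine ⟨1, fun x h r _ hx _ => ?_⟩
      simpa [abs_pow] using pow_le_pow_left₀ (abs_nonneg x) hx (k + 1)
    | succ d =>
      obtain ⟨C, hC⟩ := ih (d + 1)
      obtain ⟨C', hC'⟩ := ih d
      refine ⟨C + (d + 1) * C', fun x h r hh hx hxd => ?_⟩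
      have hr : 0 ≤ r := (abs_nonneg x).trans hx
      have h1 := hC x h r hh hx hxd
      have h2 := hC' x h r hh hx (by
        push_cast at hxd
        rw [abs_le] at *
        have : 0 ≤ (d : K) * h := by positivity
        constructor <;> nlinarith)
      rw [fwdDiff_iter_succ_pow_succ]
      push_cast at hxd h1 ⊢
      set A := (fwdDiff h)^[d + 1] (fun y => y ^ k) x
      set B := (fwdDiff h)^[d] (fun y => y ^ k) x
      calc r ^ (d + 1) * |(x + (d + 1) * h) * A + (d + 1) * h * B|
          ≤ r ^ (d + 1) * (r * |A| + (d + 1) * h * |B|) := by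
            refine mul_le_mul_of_nonneg_left ((abs_add_le _ _).trans ?_) (by positivity)
            rw [abs_mul, abs_mul ((d + 1) * h), abs_of_nonneg (show 0 ≤ (d + 1) * h by positivity)]
            gcongr
        _ = r * (r ^ (d + 1) * |A|) + (d + 1) * h * r * (r ^ d * |B|) := by ring
        _ ≤ r * (C * (h ^ (d + 1) * r ^ k)) + (d + 1) * h * r * (C' * (h ^ d * r ^ k)) := by
            gcongr
        _ = _ := by ring

/-- If the term of index `d` of a polynomial dominates all later ones by more than every integer
factor at radius `r`, then its `d`-th differences are comparable with those of that term. -/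
theorem le_abs_fwdDiff_iter_of_dominant {a : ℕ → K} {d : ℕ} {r h x : K} (hr : 0 < r)
    (hdom : ∀ k > d, ∀ m : ℕ, m * |a k * r ^ k| ≤ |a d * r ^ d|) (hh : 0 ≤ h)
    (hx : |x| ≤ r) (hxd : |x + d * h| ≤ r) {n : ℕ} (hn : d < n) :
    h ^ d * |a d| ≤ 2 * |(fwdDiff h)^[d] (fun y => ∑ k ∈ Finset.range n, a k * y ^ k) x| := by
  rw [fwdDiff_iter_sum_mul_pow, ← Finset.add_sum_erase _ _ (Finset.mem_range.2 hn),
    fwdDiff_iter_pow_self]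
  set E := ∑ k ∈ (Finset.range n).erase d, a k * (fwdDiff h)^[d] (fun y => y ^ k) x with hE
  have hn0 : (0 : K) < n := by exact_mod_cast (Nat.zero_le d).trans_lt hn
  have hterm : ∀ k ∈ (Finset.range n).erase d,
      r ^ d * |a k * (fwdDiff h)^[d] (fun y => y ^ k) x| ≤ h ^ d * |a d * r ^ d| / (2 * n) := by
    intro k hk
    rcases lt_or_gt_of_ne (Finset.ne_of_mem_erase hk) with hlt | hgt
    · rw [fwdDiff_iter_pow_of_lt h hlt, mul_zero, abs_zero, mul_zero]
      positivity
    · obtain ⟨C, hC⟩ := exists_abs_fwdDiff_iter_pow_le K d k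
      have h1 := hC x h r hh hx hxd
      -- With this multiple each later term costs at most a fraction `1/(2n)`, so together they cost
      -- at most half of the main term.
      have h2 := hdom k hgt (2 * n * C)
      rw [le_div_iff₀ (by positivity), abs_mul]
      rw [abs_mul, abs_of_nonneg (show 0 ≤ r ^ k by positivity)] at h2
      push_cast at h2
      calc r ^ d * (|a k| * |(fwdDiff h)^[d] (fun y => y ^ k) x|) * (2 * n)
          = |a k| * (2 * n) * (r ^ d * |(fwdDiff h)^[d] (fun y => y ^ k) x|) := by ring
        _ ≤ |a k| * (2 * n) * (C * (h ^ d * r ^ k)) := by gcongr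
        _ = h ^ d * (2 * n * C * (|a k| * r ^ k)) := by ring
        _ ≤ _ := by gcongr
  have hEb : r ^ d * |E| ≤ h ^ d * |a d * r ^ d| / 2 := by
    calc r ^ d * |E| ≤ r ^ d * ∑ k ∈ (Finset.range n).erase d,
          |a k * (fwdDiff h)^[d] (fun y => y ^ k) x| := by
            gcongr; exact Finset.abs_sum_le_sum_abs _ _
      _ ≤ ∑ k ∈ (Finset.range n).erase d, h ^ d * |a d * r ^ d| / (2 * n) := by
            rw [Finset.mul_sum]; exact Finset.sum_le_sum hterm
      _ ≤ n * (h ^ d * |a d * r ^ d| / (2 * n)) := by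
            rw [Finset.sum_const, nsmul_eq_mul]
            refine mul_le_mul_of_nonneg_right ?_ (by positivity)
            exact_mod_cast (Finset.card_erase_le).trans (Finset.card_range n).le
      _ = _ := by field_simp
  have hrd : 0 < r ^ d := by positivity
  rw [abs_mul, abs_of_pos hrd] at hEb
  have hE2 : |E| ≤ h ^ d * |a d| / 2 := by
    by_contra! hc
    nlinarith
  have hfac : (1 : K) ≤ d.factorial := by exact_mod_cast d.factorial_pos
  have hmain : h ^ d * |a d| ≤ |a d * (d.factorial * h ^ d)| := by
    rw [abs_mul, abs_of_nonneg (show 0 ≤ (d.factorial : K) * h ^ d by positivity)]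
    have : 0 ≤ h ^ d * |a d| := by positivity
    nlinarith
  have := abs_sub_abs_le_abs_add (a d * (d.factorial * h ^ d)) E
  linarith

end ForwardDifference

/-! ### Abel's inequality -/

section Abel

variable {K : Type*} [Field K] [LinearOrder K] [IsStrictOrderedRing K]

/-- Abel's inequality. -/
theorem abs_sum_mul_pow_le_of_abs_sum_le {c : ℕ → K} {η t : K} (ht0 : 0 ≤ t) (ht1 : t ≤ 1) {m : ℕ}
    (hc : ∀ j ≤ m, |∑ k ∈ Finset.range j, c k| ≤ η) :
    |∑ k ∈ Finset.range m, c k * t ^ k| ≤ η := by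
  have hη : 0 ≤ η := by simpa using hc 0 (Nat.zero_le _)
  -- Summation by parts: the difference is a combination of partial sums with weights `t^k - t^(k+1)
  -- ≥ 0`, which add up to `1 - t^j`.
  have key : ∀ j ≤ m, |∑ k ∈ Finset.range j, c k * t ^ k - t ^ j * ∑ k ∈ Finset.range j, c k| ≤
      η * (1 - t ^ j) := by
    intro j
    induction j with
    | zero => simp
    | succ j ih =>
      intro hj
      have h1 := ih (by omega)
      have h2 := hc (j + 1) hj
      rw [Finset.sum_range_succ] at h2
      rw [Finset.sum_range_succ, Finset.sum_range_succ]
      set A := ∑ k ∈ Finset.range j, c k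
      set B := ∑ k ∈ Finset.range j, c k * t ^ k
      have h3 : 0 ≤ t ^ j * (1 - t) := mul_nonneg (pow_nonneg ht0 j) (by linarith)
      calc |B + c j * t ^ j - t ^ (j + 1) * (A + c j)|
          = |(B - t ^ j * A) + t ^ j * (1 - t) * (A + c j)| := by congr 1; ring
        _ ≤ |B - t ^ j * A| + t ^ j * (1 - t) * |A + c j| := by
            refine (abs_add_le _ _).trans_eq ?_
            rw [abs_mul, abs_of_nonneg h3]
        _ ≤ η * (1 - t ^ j) + t ^ j * (1 - t) * η := by gcongr
        _ = η * (1 - t ^ (j + 1)) := by ring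
  have h1 := key m le_rfl
  have h2 := hc m le_rfl
  have h3 : 0 ≤ t ^ m := pow_nonneg ht0 m
  set A := ∑ k ∈ Finset.range m, c k
  set B := ∑ k ∈ Finset.range m, c k * t ^ k
  calc |B| = |(B - t ^ m * A) + t ^ m * A| := by congr 1; ring
    _ ≤ |B - t ^ m * A| + t ^ m * |A| := by
        refine (abs_add_le _ _).trans_eq ?_
        rw [abs_mul, abs_of_nonneg h3]
    _ ≤ η * (1 - t ^ m) + t ^ m * η := by gcongr
    _ = η := by ring

end Abel

/-! ### Sign changes on short intervals -/

section Refinement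

open Polynomial

variable {K : Type*} [Field K] [LinearOrder K] [IsStrictOrderedRing K]

omit [IsStrictOrderedRing K] in
theorem Polynomial.finite_setOf_mem_Icc_eval_eq {p : K[X]} {α β v : K} (h : p.eval α ≠ v) :
    {x | x ∈ Icc α β ∧ p.eval x = v}.Finite := by
  have hp : p - C v ≠ 0 := fun h0 => h (by
    have := congrArg (eval α) h0
    simpa [sub_eq_zero] using this)
  refine (p - C v).roots.toFinset.finite_toSet.subset fun x hx => ?_
  simp [hp, hx.2]

theorem IsRealClosed.exists_eval_eq [IsRealClosed K] (p : K[X]) {α β v : K} (hαβ : α < β)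
    (h : (p.eval α - v) * (p.eval β - v) < 0) : ∃ x ∈ Ioo α β, p.eval x = v := by
  obtain ⟨z, hz, hr⟩ := exists_isRoot_mem_Ioo (p - C v) hαβ (by simpa using h)
  exact ⟨z, hz, by simpa [IsRoot, sub_eq_zero] using hr⟩

/-- A polynomial going from below `-η` to above `η` crosses the strip between on an interval. -/
theorem IsRealClosed.exists_crossing [IsRealClosed K] (p : K[X]) {α β η : K} (hη : 0 < η)
    (hαβ : α < β) (hα : p.eval α < -η) (hβ : η < p.eval β) :
    ∃ s t, α ≤ s ∧ s < t ∧ t ≤ β ∧ p.eval s = -η ∧ p.eval t = η ∧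
      ∀ x ∈ Icc s t, |p.eval x| ≤ η := by
  -- Take the first point `t` at level `η`, then the last `s` before it at level `-η`. They exist
  -- because level sets are finite, without order completeness.
  obtain ⟨t, ⟨ht, hte⟩, htmin⟩ := exists_min_image {x | x ∈ Icc α β ∧ p.eval x = η} id
    (finite_setOf_mem_Icc_eval_eq (by linarith)) (by
      obtain ⟨x, hx, he⟩ := exists_eval_eq p (v := η) hαβ (by nlinarith)
      exact ⟨x, Ioo_subset_Icc_self hx, he⟩)
  have hαt : α < t := lt_of_le_of_ne ht.1 (by rintro rfl; linarith)
  obtain ⟨s, ⟨hs, hse⟩, hsmax⟩ := exists_max_image {x | x ∈ Icc α t ∧ p.eval x = -η} id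
    (finite_setOf_mem_Icc_eval_eq (by linarith)) (by
      obtain ⟨x, hx, he⟩ := exists_eval_eq p (v := -η) hαt (by nlinarith)
      exact ⟨x, Ioo_subset_Icc_self hx, he⟩)
  have hst : s < t := lt_of_le_of_ne hs.2 (by rintro rfl; linarith)
  refine ⟨s, t, hs.1, hst, ht.2, hse, hte, fun x hx => ?_⟩
  rw [abs_le]
  constructor
  · by_contra! hc
    have hxt : x < t := lt_of_le_of_ne hx.2 (by rintro rfl; linarith)
    obtain ⟨y, hy, he⟩ := exists_eval_eq p (v := -η) hxt (by nlinarith)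
    have := hsmax y ⟨⟨hs.1.trans (hx.1.trans hy.1.le), hy.2.le⟩, he⟩
    simp only [id] at this
    linarith [hy.1, hx.1]
  · by_contra! hc
    have hαx : α < x := lt_of_le_of_ne (hs.1.trans hx.1) (by rintro rfl; linarith)
    obtain ⟨y, hy, he⟩ := exists_eval_eq p (v := η) hαx (by nlinarith)
    have := htmin y ⟨⟨hy.1.le, hy.2.le.trans (hx.2.trans ht.2)⟩, he⟩
    simp only [id] at this
    linarith [hy.2, hx.2]

/-- Every sign change of `f` in `[a, b]` persists in arbitrarily short subintervals. -/
def SignChangeRefinable (f : K → K) (a b : K) : Prop :=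
  ∀ α β, a ≤ α → α < β → β ≤ b → f α < 0 → 0 < f β → ∀ ε > 0,
    ∃ s t, α ≤ s ∧ s < t ∧ t ≤ β ∧ t - s < ε ∧ f s < 0 ∧ 0 < f t

theorem signChangeRefinable_of_eval_large [IsRealClosed K] {P : ℕ → K[X]} {f : K → K} {a b : K}
    (hU : ∀ η > 0, ∃ N, ∀ n ≥ N, ∀ x ∈ Icc a b, |(P n).eval x - f x| < η)
    (hP : ∀ ε > 0, ∃ η > 0, ∃ N, ∀ n ≥ N, ∀ s t, a ≤ s → t ≤ b → ε ≤ t - s →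
      ∃ x ∈ Icc s t, η < |(P n).eval x|) : SignChangeRefinable f a b := by
  intro α β haα hαβ hβb hα hβ ε hε
  obtain ⟨η₀, hη₀, N, hN⟩ := hP ε hε
  -- The factor 2 leaves the approximating polynomial outside the strip at `α` and `β`.
  obtain ⟨η, hη, hle, hlα, hlβ⟩ : ∃ η > 0, η ≤ η₀ ∧ 2 * η ≤ -f α ∧ 2 * η ≤ f β := by
    refine ⟨min η₀ (min (-f α / 2) (f β / 2)), by simp [hη₀, hα, hβ], min_le_left _ _, ?_, ?_⟩
    · linarith [(min_le_right η₀ _).trans (min_le_left (-f α / 2) (f β / 2))]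
    · linarith [(min_le_right η₀ _).trans (min_le_right (-f α / 2) (f β / 2))]
  obtain ⟨M, hM⟩ := hU η hη
  have hclose := hM (max N M) (le_max_right _ _)
  have hlarge := hN (max N M) (le_max_left _ _)
  set p := P (max N M)
  have h1 := abs_lt.1 (hclose α ⟨haα, hαβ.le.trans hβb⟩)
  have h2 := abs_lt.1 (hclose β ⟨haα.trans hαβ.le, hβb⟩)
  obtain ⟨s, t, hs, hst, ht, hps, hpt, hle'⟩ :=
    IsRealClosed.exists_crossing p hη hαβ (by linarith) (by linarith)
  have h3 := abs_lt.1 (hclose s ⟨haα.trans hs, hst.le.trans (ht.trans hβb)⟩)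
  have h4 := abs_lt.1 (hclose t ⟨haα.trans (hs.trans hst.le), ht.trans hβb⟩)
  refine ⟨s, t, hs, hst, ht, ?_, by linarith, by linarith⟩
  by_contra! hc
  obtain ⟨x, hx, hlt⟩ := hlarge s t (haα.trans hs) (ht.trans hβb) hc
  linarith [hle' x hx]

theorem signChangeRefinable_of_archimedean [Archimedean K] {f : K → K} {a b : K}
    (hf : ∀ s t, a ≤ s → s < t → t ≤ b → ∃ x ∈ Ioo s t, f x ≠ 0) :
    SignChangeRefinable f a b := by
  intro α β haα hαβ hβb hα hβ ε hε
  have key : ∀ k : ℕ, ∃ s t, α ≤ s ∧ s < t ∧ t ≤ β ∧ t - s ≤ (2 / 3) ^ k * (β - α) ∧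
      f s < 0 ∧ 0 < f t := by
    intro k
    induction k with
    | zero => exact ⟨α, β, le_rfl, hαβ, le_rfl, by simp, hα, hβ⟩
    | succ k ih =>
      obtain ⟨s, t, hs, hst, ht, hlen, hfs, hft⟩ := ih
      -- Cutting inside the middle third leaves at most two thirds of the length on either side.
      obtain ⟨x, hx, hfx⟩ := hf (s + (t - s) / 3) (t - (t - s) / 3) (by linarith) (by linarith)
        (by linarith)
      obtain ⟨hx1, hx2⟩ := hx
      rcases lt_or_gt_of_ne hfx with h | h
      · exact ⟨x, t, by linarith, by linarith, ht, by rw [pow_succ]; linarith, h, hft⟩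
      · exact ⟨s, x, hs, by linarith, by linarith, by rw [pow_succ]; linarith, hfs, h⟩
  obtain ⟨k, hk⟩ := exists_pow_lt_of_lt_one (show 0 < ε / (β - α) from
    div_pos hε (sub_pos.2 hαβ)) (show (2 / 3 : K) < 1 by norm_num)
  obtain ⟨s, t, hs, hst, ht, hlen, hfs, hft⟩ := key k
  exact ⟨s, t, hs, hst, ht, hlen.trans_lt ((lt_div_iff₀ (sub_pos.2 hαβ)).1 hk), hfs, hft⟩

omit [IsStrictOrderedRing K] in
theorem exists_nested_signChanges {f : K → K} {a b : K} (hf : SignChangeRefinable f a b)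
    (hab : a < b) (ha : f a < 0) (hb : 0 < f b) {ε : ℕ → K} (hε : ∀ k, 0 < ε k) :
    ∃ s t : ℕ → K, Monotone s ∧ Antitone t ∧ (∀ k, s k < t k) ∧ (∀ k, a ≤ s k ∧ t k ≤ b) ∧
      (∀ k, f (s k) < 0 ∧ 0 < f (t k)) ∧ ∀ k, t (k + 1) - s (k + 1) < ε k := by
  let T := {p : K × K // a ≤ p.1 ∧ p.1 < p.2 ∧ p.2 ≤ b ∧ f p.1 < 0 ∧ 0 < f p.2}
  have step : ∀ (k : ℕ) (p : T), ∃ q : T, p.1.1 ≤ q.1.1 ∧ q.1.2 ≤ p.1.2 ∧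
      q.1.2 - q.1.1 < ε k := by
    rintro k ⟨⟨α, β⟩, h1, h2, h3, h4, h5⟩
    obtain ⟨s, t, hs, hst, ht, hlt, hfs, hft⟩ := hf α β h1 h2 h3 h4 h5 (ε k) (hε k)
    exact ⟨⟨(s, t), h1.trans hs, hst, ht.trans h3, hfs, hft⟩, hs, ht, hlt⟩
  choose g hg1 hg2 hg3 using step
  let u : ℕ → T := fun n => Nat.rec ⟨(a, b), le_rfl, hab, le_rfl, ha, hb⟩ g n
  exact ⟨fun k => (u k).1.1, fun k => (u k).1.2, monotone_nat_of_le_succ fun k => hg1 k (u k),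
    antitone_nat_of_succ_le fun k => hg2 k (u k), fun k => (u k).2.2.1,
    fun k => ⟨(u k).2.1, (u k).2.2.2.1⟩, fun k => (u k).2.2.2.2, fun k => hg3 k (u k)⟩

end Refinement

/-! ### Nested sign changes and their limit -/

section Limit

open Polynomial

variable {K : Type*} [Field K] [LinearOrder K] [IsStrictOrderedRing K]

theorem exists_pos_seq_tendsto_zero [TopologicalSpace K] [OrderTopology K]
    (h : (𝓝 (0 : K)).IsCountablyGenerated) :
    ∃ ε : ℕ → K, (∀ k, 0 < ε k) ∧ Tendsto ε atTop (𝓝 0) := by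
  obtain ⟨ε, hε⟩ := exists_seq_tendsto (𝓝[>] (0 : K))
  obtain ⟨h1, h2⟩ := tendsto_nhdsWithin_iff.1 hε
  obtain ⟨N, hN⟩ := eventually_atTop.1 h2
  exact ⟨fun k => ε (k + N), fun k => hN _ (Nat.le_add_left _ _),
    (tendsto_add_atTop_iff_nat N).2 h1⟩

theorem exists_mem_all_Icc_of_nested [UniformSpace K] [IsUniformAddGroup K] [OrderTopology K]
    [CompleteSpace K] {s t ε : ℕ → K} (hs : Monotone s) (ht : Antitone t) (hst : ∀ k, s k < t k)
    (hε : Tendsto ε atTop (𝓝 0)) (hlen : ∀ k, t (k + 1) - s (k + 1) < ε k) :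
    ∃ c, (∀ k, c ∈ Icc (s k) (t k)) ∧ Tendsto s atTop (𝓝 c) ∧ Tendsto t atTop (𝓝 c) := by
  have hmem : ∀ k, ∀ j ≥ k, s k ≤ s j ∧ s j ≤ t k := fun k j hj =>
    ⟨hs hj, (hst j).le.trans (ht hj)⟩
  have hsmall : ∀ δ > 0, ∃ k, t k - s k < δ := by
    intro δ hδ
    obtain ⟨k, hk⟩ := (hε.eventually (gt_mem_nhds hδ)).exists
    exact ⟨k + 1, (hlen k).trans hk⟩
  have hcauchy : CauchySeq s := by
    rw [cauchySeq_iff_tendsto, uniformity_eq_comap_nhds_zero, tendsto_comap_iff,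
      LinearOrderedAddCommGroup.tendsto_nhds]
    intro δ hδ
    obtain ⟨k, hk⟩ := hsmall δ hδ
    filter_upwards [eventually_ge_atTop (k, k)] with ij hij
    have h1 := hmem k ij.1 hij.1
    have h2 := hmem k ij.2 hij.2
    simp only [Function.comp, Prod.map, sub_zero, abs_lt]
    constructor <;> linarith
  obtain ⟨c, hc⟩ := cauchySeq_tendsto_of_complete hcauchy
  have hcmem : ∀ k, c ∈ Icc (s k) (t k) := fun k =>
    ⟨ge_of_tendsto hc (eventually_atTop.2 ⟨k, fun j hj => (hmem k j hj).1⟩),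
      le_of_tendsto hc (eventually_atTop.2 ⟨k, fun j hj => (hmem k j hj).2⟩)⟩
  refine ⟨c, hcmem, hc, LinearOrderedAddCommGroup.tendsto_nhds.2 fun δ hδ => ?_⟩
  obtain ⟨k, hk⟩ := hsmall δ hδ
  filter_upwards [eventually_ge_atTop k] with j hj
  have h1 := hcmem k
  have h2 := (hcmem j).2
  have h3 := ht hj
  rw [abs_lt]
  constructor <;> linarith [h1.1, h1.2]

/-- One-sided continuity of a uniform limit; used for `f` along left ends and for `-f` along right
ends. -/
theorem le_of_uniform_approx [TopologicalSpace K] [OrderTopology K] {P : ℕ → K[X]} {f : K → K}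
    {a b : K} (hU : ∀ η > 0, ∃ N, ∀ n ≥ N, ∀ x ∈ Icc a b, |(P n).eval x - f x| < η) {c : K}
    (hc : c ∈ Icc a b) {s : ℕ → K} (hs : ∀ k, s k ∈ Icc a b) (hsc : Tendsto s atTop (𝓝 c)) {v : K}
    (hv : ∀ k, f (s k) ≤ v) : f c ≤ v := by
  refine le_of_forall_pos_le_add fun δ hδ => ?_
  obtain ⟨N, hN⟩ := hU (δ / 2) (half_pos hδ)
  have h1 : (P N).eval c ≤ v + δ / 2 := by
    refine le_of_tendsto (((P N).continuous.tendsto c).comp hsc) (Eventually.of_forall fun k => ?_)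
    have := abs_lt.1 (hN N le_rfl (s k) (hs k))
    simp only [Function.comp]
    linarith [hv k]
  have := abs_lt.1 (hN N le_rfl c hc)
  linarith

theorem exists_zero_approximated_of_neg_of_pos [IsRealClosed K] [UniformSpace K]
    [IsUniformAddGroup K]
    [OrderTopology K] [CompleteSpace K] (hcount : (𝓝 (0 : K)).IsCountablyGenerated)
    {P : ℕ → K[X]} {f : K → K} {a b : K}
    (hU : ∀ η > 0, ∃ N, ∀ n ≥ N, ∀ x ∈ Icc a b, |(P n).eval x - f x| < η)
    (hf : SignChangeRefinable f a b) (hab : a < b) (ha : f a < 0) (hb : 0 < f b) :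
    ∃ c ∈ Icc a b, f c = 0 ∧
      ∀ U ∈ 𝓝 c, ∀ᶠ n in atTop, ∃ z ∈ U, z ∈ Icc a b ∧ (P n).eval z = 0 := by
  obtain ⟨ε, hε0, hε⟩ := exists_pos_seq_tendsto_zero hcount
  obtain ⟨s, t, hs, ht, hst, hab', hsign, hlen⟩ := exists_nested_signChanges hf hab ha hb hε0
  obtain ⟨c, hc, hsc, htc⟩ := exists_mem_all_Icc_of_nested hs ht hst hε hlen
  have hcab : c ∈ Icc a b := ⟨(hab' 0).1.trans (hc 0).1, (hc 0).2.trans (hab' 0).2⟩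
  have hsab : ∀ k, s k ∈ Icc a b := fun k => ⟨(hab' k).1, (hst k).le.trans (hab' k).2⟩
  have htab : ∀ k, t k ∈ Icc a b := fun k => ⟨(hab' k).1.trans (hst k).le, (hab' k).2⟩
  refine ⟨c, hcab, le_antisymm ?_ ?_, fun U hUc => ?_⟩
  · exact le_of_uniform_approx hU hcab hsab hsc fun k => (hsign k).1.le
  · refine neg_nonpos.1 (le_of_uniform_approx (P := fun n => -P n) (f := fun x => -f x) ?_ hcab htab
      htc fun k => neg_nonpos.2 (hsign k).2.le)
    intro η hη
    obtain ⟨N, hN⟩ := hU η hη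
    refine ⟨N, fun n hn x hx => ?_⟩
    rw [eval_neg, neg_sub_neg, abs_sub_comm]
    exact hN n hn x hx
  · obtain ⟨k, hk⟩ := ((hsc.Icc htc).eventually (eventually_smallSets_subset.2 hUc)).exists
    obtain ⟨η, hη, h1, h2⟩ : ∃ η > 0, η ≤ -f (s k) ∧ η ≤ f (t k) :=
      ⟨min (-f (s k)) (f (t k)), by simp [hsign k], min_le_left _ _, min_le_right _ _⟩
    obtain ⟨N, hN⟩ := hU η hη
    filter_upwards [eventually_ge_atTop N] with n hn
    have h3 := abs_lt.1 (hN n hn _ (hsab k))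
    have h4 := abs_lt.1 (hN n hn _ (htab k))
    obtain ⟨z, hz, hr⟩ := IsRealClosed.exists_isRoot_mem_Ioo (P n) (hst k)
      (mul_neg_of_neg_of_pos (by linarith) (by linarith))
    exact ⟨z, hk (Ioo_subset_Icc_self hz),
      ⟨(hab' k).1.trans hz.1.le, hz.2.le.trans (hab' k).2⟩, hr⟩

end Limit

/-! ### The Archimedean case: the identity theorem -/

/-- The identity theorem for real power series, in terms of partial sums. -/
theorem Real.eq_zero_of_frequently_tendsto_partialSum_zero {a : ℕ → ℝ} {ρ x₀ : ℝ} (hρ : 0 < ρ)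
    (ha : Tendsto (fun k => a k * ρ ^ k) atTop (𝓝 0)) (hx₀ : |x₀| < ρ)
    (hfreq : ∃ᶠ x in 𝓝[≠] x₀,
      Tendsto (fun n => ∑ k ∈ Finset.range n, a k * x ^ k) atTop (𝓝 0)) : a = 0 := by
  set p := FormalMultilinearSeries.ofScalars ℝ a with hp
  have hrad : ENNReal.ofReal ρ ≤ p.radius := by
    refine p.le_radius_of_tendsto (r := ρ.toNNReal) (l := 0) ?_
    simpa [hp, FormalMultilinearSeries.ofScalars_norm, Real.coe_toNNReal _ hρ.le, abs_mul,
      abs_of_pos hρ] using ha.abs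
  have hρ' : 0 < ENNReal.ofReal ρ := ENNReal.ofReal_pos.2 hρ
  have hball : HasFPowerSeriesOnBall p.sum p 0 (ENNReal.ofReal ρ) :=
    (p.hasFPowerSeriesOnBall (hρ'.trans_le hrad)).mono hρ' hrad
  have hmem : ∀ x : ℝ, |x| < ρ → x ∈ Metric.eball (0 : ℝ) (ENNReal.ofReal ρ) := by
    intro x hx
    rw [Metric.eball_ofReal]
    simpa using hx
  have hzero : EqOn p.sum 0 (Metric.eball (0 : ℝ) (ENNReal.ofReal ρ)) := by
    refine hball.analyticOnNhd.eqOn_zero_of_preconnected_of_frequently_eq_zero ?_ (hmem x₀ hx₀) ?_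
    · rw [Metric.eball_ofReal]
      exact (convex_ball _ _).isPreconnected
    · have hnear : ∀ᶠ x in 𝓝[≠] x₀, |x| < ρ :=
        nhdsWithin_le_nhds (continuous_abs.continuousAt.eventually_lt continuousAt_const hx₀)
      refine (hfreq.and_eventually hnear).mono fun x hx => ?_
      have h1 := (hball.hasSum (hmem x hx.2)).tendsto_sum_nat
      rw [zero_add] at h1
      refine tendsto_nhds_unique h1 ?_
      simpa [hp, FormalMultilinearSeries.ofScalars_apply_eq, mul_comm] using hx.1
  have hp0 : p = 0 := hball.hasFPowerSeriesAt.locally_zero_iff.1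
    (hzero.eventuallyEq_of_mem (Metric.eball_mem_nhds _ hρ'))
  exact (FormalMultilinearSeries.ofScalars_series_eq_zero ℝ).1 hp0

section OrderEmbedding

variable {K : Type*} [Field K] [LinearOrder K] [IsStrictOrderedRing K] [TopologicalSpace K]
  [OrderTopology K]

/-- The bounds `1/(n+1)` lie in `K`, are fixed by `φ`, and get below every positive real. -/
theorem OrderRingHom.tendsto_zero_real (φ : K →+*o ℝ) {ι : Type*} {l : Filter ι} {u : ι → K}
    (hu : Tendsto u l (𝓝 0)) : Tendsto (fun i => φ (u i)) l (𝓝 0) := by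
  rw [LinearOrderedAddCommGroup.tendsto_nhds] at hu ⊢
  intro δ hδ
  obtain ⟨n, hn⟩ := exists_nat_one_div_lt hδ
  filter_upwards [hu (1 / (n + 1)) (by positivity)] with i hi
  rw [sub_zero, abs_lt] at hi ⊢
  have h1 := φ.monotone' hi.1.le
  have h2 := φ.monotone' hi.2.le
  simp at h1 h2 hn
  constructor <;> linarith

/-- The identity theorem for power series over an Archimedean ordered field. -/
theorem exists_not_tendsto_partialSum_zero_of_archimedean [Archimedean K] {c : ℕ → K} {r s t : K}
    (hr : Tendsto (fun k => c k * r ^ k) atTop (𝓝 0)) (hs : -|r| ≤ s) (hst : s < t) (ht : t ≤ |r|)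
    (hc : c ≠ 0) :
    ∃ x ∈ Ioo s t, ¬ Tendsto (fun n => ∑ k ∈ Finset.range n, c k * x ^ k) atTop (𝓝 0) := by
  by_contra! hall
  obtain ⟨φ⟩ := Real.nonemptyOrderRingHom K
  have hinj : StrictMono φ := φ.monotone'.strictMono_of_injective φ.toRingHom.injective
  have hr0 : 0 < |r| := by linarith
  refine hc (funext fun k => ?_)
  suffices h : (fun k => φ (c k)) = 0 by simpa using congrFun h k
  set m := s + (t - s) / 2 with hm
  refine Real.eq_zero_of_frequently_tendsto_partialSum_zero (ρ := φ |r|) (x₀ := φ m) ?_ ?_ ?_ ?_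
  · simpa using hinj hr0
  · have := φ.tendsto_zero_real hr
    refine (tendsto_zero_iff_abs_tendsto_zero _).2 ?_
    have h2 := (tendsto_zero_iff_abs_tendsto_zero _).1 this
    refine h2.congr fun k => ?_
    rcases abs_choice r with h | h <;> simp [h, Function.comp, abs_mul, abs_pow]
  · rw [abs_lt, ← map_neg]
    exact ⟨hinj (by linarith), hinj (by linarith)⟩
  -- Vanishing is known only at images of points of `K`, so a sequence of these accumulating at `φ
  -- m` is supplied.
  · have hx : ∀ n : ℕ, m + (t - s) / 2 * (1 / (n + 2)) ∈ Ioo s t := by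
      intro n
      have h1 : 0 < (1 : K) / (n + 2) := by positivity
      have h2 : (1 : K) / (n + 2) < 1 := by
        rw [div_lt_one (by positivity)]
        have : (0 : K) ≤ n := n.cast_nonneg
        linarith
      constructor <;> nlinarith
    have hlim : Tendsto (fun n : ℕ => φ (m + (t - s) / 2 * (1 / (n + 2)))) atTop
        (𝓝[≠] (φ m)) := by
      refine tendsto_nhdsWithin_iff.2 ⟨?_, Eventually.of_forall fun n => ?_⟩
      · have h1 : Tendsto (fun n : ℕ => (1 : ℝ) / (n + 2)) atTop (𝓝 0) := by
          have := (tendsto_one_div_add_atTop_nhds_zero_nat (𝕜 := ℝ)).comp (tendsto_add_atTop_nat 1)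
          refine this.congr fun n => ?_
          simp only [Function.comp]
          push_cast
          ring
        have h2 := (h1.const_mul (φ ((t - s) / 2))).const_add (φ m)
        rw [mul_zero, add_zero] at h2
        refine h2.congr fun n => ?_
        simp only [map_add, map_mul, map_div₀, map_one, map_natCast, map_ofNat]
      · refine (hinj ?_).ne'
        have : 0 < (t - s) / 2 * (1 / ((n : K) + 2)) := by
          have := sub_pos.2 hst
          positivity
        linarith
    refine hlim.frequently (Frequently.of_forall fun n => ?_)
    have := φ.tendsto_zero_real (hall _ (hx n))
    simpa using this

end OrderEmbedding

/-! ### The non-Archimedean case: dominant terms -/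

section NonArchimedean

variable {K : Type*} [Field K] [LinearOrder K] [IsStrictOrderedRing K] [TopologicalSpace K]
  [OrderTopology K]

/-- Over a non-Archimedean field a nonzero null sequence has an entry dominating all later ones by
more than every integer factor. -/
theorem exists_dominant_of_tendsto_zero (hK : ¬ Archimedean K) {u : ℕ → K}
    (hu : Tendsto u atTop (𝓝 0)) (hne : u ≠ 0) :
    ∃ d, u d ≠ 0 ∧ ∀ k > d, ∀ m : ℕ, m * |u k| ≤ |u d| := by
  obtain ⟨ω, hω⟩ : ∃ ω : K, ∀ n : ℕ, (n : K) ≤ ω := by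
    by_contra! h
    exact hK (archimedean_iff_nat_lt.2 h)
  have hω0 : 0 < ω := one_pos.trans_le (by simpa using hω 1)
  obtain ⟨j, hj⟩ := Function.ne_iff.1 hne
  simp only [Pi.zero_apply] at hj
  have hj' : 0 < |u j| := abs_pos.2 hj
  obtain ⟨N, hN⟩ := eventually_atTop.1
    (LinearOrderedAddCommGroup.tendsto_nhds.1 hu (|u j| / ω) (by positivity))
  have hsmall : ∀ k ≥ N, ∀ m : ℕ, m * |u k| ≤ |u j| := by
    intro k hk m
    have h1 := hN k hk
    rw [sub_zero, lt_div_iff₀ hω0] at h1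
    nlinarith [mul_le_mul_of_nonneg_right (hω m) (abs_nonneg (u k))]
  classical
  -- `p k`: the entry `u k` is not infinitely small relative to `u j`. This holds for finitely many
  -- `k` only; the last one is the required `d`.
  set p : ℕ → Prop := fun k => ∃ m : ℕ, |u j| < m * |u k| with hp
  have hpj : p j := ⟨2, by push_cast; linarith⟩
  have hlt : ∀ k, p k → k < N := fun k ⟨m, hm⟩ => by
    by_contra! hc
    exact (hsmall k hc m).not_gt hm
  obtain ⟨M, hM⟩ := Nat.findGreatest_spec (P := p) (hlt j hpj).le hpj
  set d := Nat.findGreatest p N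
  refine ⟨d, fun h0 => ?_, fun k hk m => ?_⟩
  · rw [h0, abs_zero, mul_zero] at hM
    linarith
  · have hk' : ¬ p k := fun h => (Nat.findGreatest_is_greatest hk (hlt k h).le) h
    simp only [hp, not_exists, not_lt] at hk'
    have h1 := hk' (M * m)
    push_cast at h1
    by_contra! hc
    have hM0 : (0 : K) < M := by
      by_contra! h
      nlinarith [abs_nonneg (u d)]
    nlinarith

theorem exists_lt_abs_sum_of_not_archimedean (hK : ¬ Archimedean K) {c : ℕ → K} {r : K}
    (hr0 : r ≠ 0) (hr : Tendsto (fun k => c k * r ^ k) atTop (𝓝 0)) (hc : c ≠ 0) {ε : K}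
    (hε : 0 < ε) : ∃ η > 0, ∃ N, ∀ n ≥ N, ∀ s t, -|r| ≤ s → t ≤ |r| → ε ≤ t - s →
      ∃ x ∈ Icc s t, η < |∑ k ∈ Finset.range n, c k * x ^ k| := by
  have hpos : 0 < |r| := abs_pos.2 hr0
  obtain ⟨d, hd0, hd⟩ := exists_dominant_of_tendsto_zero hK hr (fun h => hc (funext fun k => by
    simpa [hr0] using congrFun h k))
  have hcd : 0 < |c d| := abs_pos.2 (left_ne_zero_of_mul hd0)
  set h := ε / (d + 1) with hh
  have hh0 : 0 < h := by positivity
  have hlen : ∀ j ≤ d, (j : K) * h ≤ ε := by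
    intro j hj
    rw [hh, ← mul_div_assoc, div_le_iff₀ (by positivity), mul_comm]
    have : (j : K) ≤ d := by exact_mod_cast hj
    exact mul_le_mul_of_nonneg_left (by linarith) hε.le
  -- If the sum stayed below this `η` at `s, s + h, …, s + dh`, its `d`-th difference would be at
  -- most `2^d η = h^d |c_d| / 4`, half of the lower bound. The step `ε / (d + 1)` also covers `d =
  -- 0`.
  refine ⟨h ^ d * |c d| / (4 * 2 ^ d), by positivity, d + 1, fun n hn s t hs ht hst => ?_⟩
  by_contra! hcon
  have hj0 : ∀ j : ℕ, 0 ≤ (j : K) * h := fun j => by positivity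
  have h1 := le_abs_fwdDiff_iter_of_dominant (a := c) (d := d) (r := |r|) (h := h) (x := s) hpos
    (fun k hk m => by simpa [abs_mul, abs_pow] using hd k hk m) hh0.le
    (abs_le.2 ⟨hs, by linarith⟩)
    (abs_le.2 ⟨by linarith [hj0 d], by linarith [hlen d le_rfl]⟩) (n := n) (by omega)
  have h2 := abs_fwdDiff_iter_le (f := fun y => ∑ k ∈ Finset.range n, c k * y ^ k) (h := h) d
    (x := s) fun j hj => hcon _ ⟨by linarith [hj0 j], by linarith [hlen j hj]⟩
  have h3 : 2 ^ d * (h ^ d * |c d| / (4 * 2 ^ d)) = h ^ d * |c d| / 4 := by field_simp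
  have h4 : 0 < h ^ d * |c d| := by positivity
  linarith

end NonArchimedean

/-! ### Uniform convergence and refinability for power series -/

namespace OrderedPowerSeries

theorem eval_partialSum {K : Type*} [Field K] (S : PowerSeries K) (n : ℕ) (x : K) :
    (partialSum S n).eval x = ∑ k ∈ Finset.range (n + 1), PowerSeries.coeff k S * x ^ k := by
  exact PowerSeries.eval₂_trunc_eq_sum_range x (RingHom.id K) (n + 1) S

theorem tendsto_value {K : Type*} [Field K] [TopologicalSpace K] {S : PowerSeries K} {x : K}
    (h : ConvergesAt S x) :
    Tendsto (fun n => (partialSum S n).eval x) atTop (𝓝 (value S x)) :=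
  tendsto_nhds_limUnder h

section Convergence

variable {K : Type*} [Field K] [LinearOrder K] [IsStrictOrderedRing K] [TopologicalSpace K]
  [OrderTopology K]

theorem tendsto_coeff_mul_pow {S : PowerSeries K} {r : K} (h : ConvergesAt S r) :
    Tendsto (fun k => PowerSeries.coeff k S * r ^ k) atTop (𝓝 0) := by
  obtain ⟨v, hv⟩ := h
  have h1 := ((tendsto_add_atTop_iff_nat 1).2 hv).sub hv
  rw [sub_self] at h1
  refine (tendsto_add_atTop_iff_nat 1).1 (h1.congr fun n => ?_)
  rw [eval_partialSum, eval_partialSum, Finset.sum_range_succ _ (n + 1), add_sub_cancel_left]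

/-- Abel's theorem. -/
theorem exists_forall_abs_eval_partialSum_sub_value_le {S : PowerSeries K} {r : K}
    (h : ConvergesAt S r) {η : K} (hη : 0 < η) : ∃ N, ∀ n ≥ N, ∀ t, 0 ≤ t → t ≤ 1 →
      ConvergesAt S (t * r) →
      |(partialSum S n).eval (t * r) - value S (t * r)| ≤ η := by
  obtain ⟨v, hv⟩ := h
  obtain ⟨N, hN⟩ := eventually_atTop.1
    (LinearOrderedAddCommGroup.tendsto_nhds.1 hv (η / 2) (half_pos hη))
  refine ⟨N, fun n hn t ht0 ht1 hconv => ?_⟩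
  have hlim : Tendsto (fun m => |(partialSum S n).eval (t * r) - (partialSum S m).eval (t * r)|)
      atTop (𝓝 |(partialSum S n).eval (t * r) - value S (t * r)|) :=
    (tendsto_const_nhds.sub (tendsto_value hconv)).abs
  refine le_of_tendsto hlim (eventually_atTop.2 ⟨n, fun m hm => ?_⟩)
  set c : ℕ → K := fun k => PowerSeries.coeff k S * r ^ k with hc
  have hsplit : ∀ j x, (partialSum S (n + j)).eval x - (partialSum S n).eval x =
      ∑ k ∈ Finset.range j, PowerSeries.coeff (n + 1 + k) S * x ^ (n + 1 + k) := by
    intro j x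
    rw [eval_partialSum, eval_partialSum, show n + j + 1 = n + 1 + j by ring,
      Finset.sum_range_add, add_sub_cancel_left]
  obtain ⟨j, rfl⟩ := Nat.exists_eq_add_of_le hm
  have hbound : ∀ i ≤ j, |∑ k ∈ Finset.range i, c (n + 1 + k)| ≤ η := by
    intro i _
    rw [← hsplit]
    have h1 := abs_lt.1 (hN n hn)
    have h2 := abs_lt.1 (hN (n + i) (by omega))
    rw [abs_le]
    constructor <;> linarith
  have habel := abs_sum_mul_pow_le_of_abs_sum_le ht0 ht1 hbound
  rw [abs_sub_comm, hsplit]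
  have heq : ∑ k ∈ Finset.range j, PowerSeries.coeff (n + 1 + k) S * (t * r) ^ (n + 1 + k) =
      t ^ (n + 1) * ∑ k ∈ Finset.range j, c (n + 1 + k) * t ^ k := by
    rw [Finset.mul_sum]
    refine Finset.sum_congr rfl fun k _ => ?_
    simp only [hc]
    ring
  rw [heq, abs_mul, abs_of_nonneg (pow_nonneg ht0 _)]
  exact (mul_le_of_le_one_left (abs_nonneg _) (pow_le_one₀ ht0 ht1)).trans habel

/-- A negative `x` is `t * a` and a positive one `t * b` with `0 ≤ t ≤ 1`, so Abel's theorem at the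
two ends suffices. -/
theorem exists_forall_abs_eval_partialSum_sub_value_lt {S : PowerSeries K} {a b : K} (hab : a < b)
    (hconv : ∀ x ∈ Icc a b, ConvergesAt S x) {η : K} (hη : 0 < η) :
    ∃ N, ∀ n ≥ N, ∀ x ∈ Icc a b, |(partialSum S n).eval x - value S x| < η := by
  obtain ⟨N, hN⟩ := exists_forall_abs_eval_partialSum_sub_value_le
    (hconv a (left_mem_Icc.2 hab.le)) (half_pos hη)
  obtain ⟨M, hM⟩ := exists_forall_abs_eval_partialSum_sub_value_le
    (hconv b (right_mem_Icc.2 hab.le)) (half_pos hη)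
  refine ⟨max N M, fun n hn x hx => lt_of_le_of_lt ?_ (half_lt_self hη)⟩
  rcases lt_trichotomy x 0 with h | rfl | h
  · have ha : a < 0 := hx.1.trans_lt h
    have hxa : x / a * a = x := div_mul_cancel₀ x ha.ne
    have := hN n (le_of_max_le_left hn) (x / a) (div_nonneg_of_nonpos h.le ha.le)
      ((div_le_one_of_neg ha).2 hx.1)
    rw [hxa] at this
    exact this (hconv x hx)
  · have := hN n (le_of_max_le_left hn) 0 le_rfl zero_le_one
    rw [zero_mul] at this
    exact this (hconv 0 hx)
  · have hb : 0 < b := h.trans_le hx.2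
    have hxb : x / b * b = x := div_mul_cancel₀ x hb.ne'
    have := hM n (le_of_max_le_right hn) (x / b) (by positivity) ((div_le_one hb).2 hx.2)
    rw [hxb] at this
    exact this (hconv x hx)

theorem signChangeRefinable_value [IsRealClosed K] {S : PowerSeries K} {a b : K} (hab : a < b)
    (hconv : ∀ x ∈ Icc a b, ConvergesAt S x) (hS : S ≠ 0) :
    SignChangeRefinable (value S) a b := by
  -- `r` is the endpoint of larger absolute value.
  obtain ⟨r, hr, har, hbr⟩ : ∃ r ∈ Icc a b, -|r| ≤ a ∧ b ≤ |r| := by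
    rcases le_total |a| |b| with h | h
    · exact ⟨b, right_mem_Icc.2 hab.le, by linarith [neg_abs_le a], le_abs_self b⟩
    · exact ⟨a, left_mem_Icc.2 hab.le, neg_abs_le a, (le_abs_self b).trans h⟩
  have hr0 : r ≠ 0 := by
    rintro rfl
    rw [abs_zero] at har hbr
    linarith
  have hlim := tendsto_coeff_mul_pow (hconv r hr)
  have hc : (fun k => PowerSeries.coeff k S) ≠ 0 := fun h => hS (PowerSeries.ext fun k => by
    simpa using congrFun h k)
  by_cases hK : Archimedean K
  · refine signChangeRefinable_of_archimedean fun s t hs hst ht => ?_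
    obtain ⟨x, hx, hnot⟩ := exists_not_tendsto_partialSum_zero_of_archimedean hlim
      (har.trans hs) hst (ht.trans hbr) hc
    refine ⟨x, hx, fun h0 => hnot ((tendsto_add_atTop_iff_nat 1).1 ?_)⟩
    have := tendsto_value (hconv x ⟨hs.trans hx.1.le, hx.2.le.trans ht⟩)
    simpa only [h0, eval_partialSum] using this
  · refine signChangeRefinable_of_eval_large
      (fun η hη => exists_forall_abs_eval_partialSum_sub_value_lt hab hconv hη) fun ε hε => ?_
    obtain ⟨η, hη, N, hN⟩ := exists_lt_abs_sum_of_not_archimedean hK hr0 hlim hc hε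
    refine ⟨η, hη, N, fun n hn s t hs ht hst => ?_⟩
    simpa only [eval_partialSum] using
      hN (n + 1) (by omega) s t (har.trans hs) (ht.trans hbr) hst

end Convergence

end OrderedPowerSeries

/-! ### Accumulation of the zeros of partial sums -/

theorem accPt_principal_Icc {X : Type*} [TopologicalSpace X] [LinearOrder X] [OrderTopology X]
    [DenselyOrdered X] {a b c : X} (hab : a < b) (hc : c ∈ Icc a b) : AccPt c (𝓟 (Icc a b)) := by
  rw [accPt_principal_iff_nhdsWithin]
  rcases hc.2.lt_or_eq with h | h
  · exact (left_nhdsWithin_Ioc_neBot h).mono (nhdsWithin_mono _ fun x hx =>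
      ⟨⟨hc.1.trans hx.1.le, hx.2⟩, hx.1.ne'⟩)
  · exact (right_nhdsWithin_Ico_neBot (h ▸ hab : a < c)).mono (nhdsWithin_mono _ fun x hx =>
      ⟨⟨hx.1, hx.2.le.trans hc.2⟩, hx.2.ne⟩)

namespace OrderedPowerSeries

theorem partialSum_neg {K : Type*} [Field K] (S : PowerSeries K) (n : ℕ) :
    partialSum (-S) n = -partialSum S n :=
  map_neg (PowerSeries.trunc (n + 1)) S

theorem partialZeros_neg {K : Type*} [Field K] [LinearOrder K] (S : PowerSeries K) (a b : K)
    (n : ℕ) : partialZeros (-S) a b n = partialZeros S a b n := by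
  simp [partialZeros, partialSum_neg]

section Sign

variable {K : Type*} [Field K] [LinearOrder K] [IsStrictOrderedRing K] [TopologicalSpace K]
  [OrderTopology K]

theorem tendsto_eval_partialSum_neg {S : PowerSeries K} {x : K} (h : ConvergesAt S x) :
    Tendsto (fun n => (partialSum (-S) n).eval x) atTop (𝓝 (-value S x)) := by
  simpa only [partialSum_neg, Polynomial.eval_neg] using (tendsto_value h).neg

theorem value_neg {S : PowerSeries K} {x : K} (h : ConvergesAt S x) :
    value (-S) x = -value S x :=
  (tendsto_eval_partialSum_neg h).limUnder_eq

end Sign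

section Zeros

variable {K : Type*} [Field K] [LinearOrder K] [IsStrictOrderedRing K]

theorem exists_nearest_partialZero (S : PowerSeries K) (a b : K) (n : ℕ) {c : K}
    (hc : c ∈ Icc a b) (hne : (partialZeros S a b n).Nonempty) :
    ∃ z ∈ partialZeros S a b n, ∀ w ∈ partialZeros S a b n, |z - c| ≤ |w - c| := by
  by_cases h0 : partialSum S n = 0
  · exact ⟨c, ⟨hc, by simp [h0]⟩, fun w _ => by simp⟩
  · refine exists_min_image _ (fun z => |z - c|) ?_ hne
    refine (partialSum S n).roots.toFinset.finite_toSet.subset fun x hx => ?_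
    simp [h0, hx.2]

/-- Choosing for each `n` a zero nearest to `c` makes one sequence serve all neighbourhoods. -/
theorem exists_seq_partialZeros_tendsto [TopologicalSpace K] [OrderTopology K]
    {S : PowerSeries K} {a b c : K} (hc : c ∈ Icc a b)
    (h : ∀ U ∈ 𝓝 c, ∀ᶠ n in atTop, (U ∩ partialZeros S a b n).Nonempty) :
    ∃ z : ℕ → K, (∀ᶠ n in atTop, z n ∈ partialZeros S a b n) ∧ Tendsto z atTop (𝓝 c) := by
  have hex : ∀ n, ∃ z, (partialZeros S a b n).Nonempty →
      z ∈ partialZeros S a b n ∧ ∀ w ∈ partialZeros S a b n, |z - c| ≤ |w - c| := by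
    intro n
    by_cases hne : (partialZeros S a b n).Nonempty
    · obtain ⟨z, hz⟩ := exists_nearest_partialZero S a b n hc hne
      exact ⟨z, fun _ => hz⟩
    · exact ⟨0, fun h => absurd h hne⟩
  -- The default `0` occurs for finitely many `n` only.
  choose z hz using hex
  refine ⟨z, (h univ univ_mem).mono fun n hn => (hz n (hn.mono inter_subset_right)).1,
    LinearOrderedAddCommGroup.tendsto_nhds.2 fun ε hε => ?_⟩
  have hU : {x | |x - c| < ε} ∈ 𝓝 c :=
    LinearOrderedAddCommGroup.tendsto_nhds.1 tendsto_id ε hε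
  refine (h _ hU).mono fun n hn => ?_
  obtain ⟨w, hw, hwz⟩ := hn
  exact ((hz n ⟨w, hwz⟩).2 w hwz).trans_lt hw

/-- Two consecutive partial sums vanishing at `c` force `a_k c^k = 0`. -/
theorem exists_coe_eq_of_eventually_isRoot {S : PowerSeries K} {c : K} (hc : c ≠ 0)
    (h : ∀ᶠ n in atTop, (partialSum S n).eval c = 0) :
    ∃ P : Polynomial K, (P : PowerSeries K) = S := by
  obtain ⟨N, hN⟩ := eventually_atTop.1 h
  refine ⟨partialSum S N, PowerSeries.ext fun k => ?_⟩
  rw [Polynomial.coeff_coe, partialSum, PowerSeries.coeff_trunc]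
  split_ifs with hk
  · rfl
  · obtain ⟨j, rfl⟩ := Nat.exists_eq_add_of_lt (show N < k by omega)
    have h1 := hN (N + j) (by omega)
    have h2 := hN (N + j + 1) (by omega)
    rw [eval_partialSum] at h1 h2
    rw [Finset.sum_range_succ, h1, zero_add] at h2
    exact ((mul_eq_zero.1 h2).resolve_right (pow_ne_zero _ hc)).symm

theorem accPt_iUnion_partialZeros [TopologicalSpace K] [OrderTopology K] {S : PowerSeries K}
    {a b c : K} (hab : a < b) (hc : c ∈ Icc a b)
    (h : ∀ U ∈ 𝓝 c, ∀ᶠ n in atTop, (U ∩ partialZeros S a b n).Nonempty)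
    (hS : ¬ ∃ P : Polynomial K, (P : PowerSeries K) = S) :
    AccPt c (𝓟 (⋃ n, partialZeros S a b n)) := by
  rw [accPt_iff_nhds]
  intro U hU
  by_contra! hcon
  have hroot : ∀ᶠ n in atTop, (partialSum S n).eval c = 0 := by
    refine (h U hU).mono fun n hn => ?_
    obtain ⟨z, hzU, hz⟩ := hn
    obtain rfl := hcon z ⟨hzU, mem_iUnion.2 ⟨n, hz⟩⟩
    exact hz.2
  -- If no other zero is near `c`, then `c` is a zero of almost all `S_n`, so `c = 0` as `S` is not
  -- a polynomial. Then `a_0 = 0`, so `S_0 = 0` and `Z_0` is all of `[a, b]`, a contradiction.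
  obtain rfl : c = 0 := by
    by_contra hc0
    exact hS (exists_coe_eq_of_eventually_isRoot hc0 hroot)
  have hcoeff : PowerSeries.coeff 0 S = 0 := by
    obtain ⟨n, hn⟩ := hroot.exists
    simpa [eval_partialSum, Finset.sum_range_succ'] using hn
  have hall : ∀ x ∈ Icc a b, x ∈ partialZeros S a b 0 := fun x hx =>
    ⟨hx, by rw [eval_partialSum]; simp [hcoeff]⟩
  obtain ⟨y, ⟨hyU, hy⟩, hne⟩ := accPt_iff_nhds.1 (accPt_principal_Icc hab hc) U hU
  exact hne (hcon y ⟨hyU, mem_iUnion.2 ⟨0, hall y hy⟩⟩)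

end Zeros

theorem exists_zero_of_neg_of_pos {K : Type*} [Field K] [LinearOrder K] [IsStrictOrderedRing K]
    [IsRealClosed K] [UniformSpace K] [IsUniformAddGroup K] [OrderTopology K] [CompleteSpace K]
    (hcount : (𝓝 (0 : K)).IsCountablyGenerated) {S : PowerSeries K} {a b : K} (hab : a < b)
    (hconv : ∀ x ∈ Icc a b, ConvergesAt S x) (ha : value S a < 0) (hb : 0 < value S b) :
    ∃ c ∈ Icc a b, value S c = 0 ∧
      ∀ U ∈ 𝓝 c, ∀ᶠ n in atTop, (U ∩ partialZeros S a b n).Nonempty := by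
  have hS : S ≠ 0 := by
    rintro rfl
    have h0 := tendsto_value (hconv a (left_mem_Icc.2 hab.le))
    simp only [eval_partialSum, map_zero, zero_mul, Finset.sum_const_zero] at h0
    exact ha.ne (tendsto_nhds_unique h0 tendsto_const_nhds)
  exact exists_zero_approximated_of_neg_of_pos hcount
    (fun η hη => exists_forall_abs_eval_partialSum_sub_value_lt hab hconv hη)
    (signChangeRefinable_value hab hconv hS) hab ha hb

end OrderedPowerSeries

open OrderedPowerSeries in
theorem theorem7p1 {K : Type*} [Field K] [LinearOrder K] [IsStrictOrderedRing K]
    [IsRealClosed K]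
    [UniformSpace K] [IsUniformAddGroup K] [OrderTopology K] [CompleteSpace K]
    (hcount : (𝓝 (0 : K)).IsCountablyGenerated)
    (S : PowerSeries K) (a b : K) (hab : a < b)
    (hconv : ∀ x ∈ Icc a b, OrderedPowerSeries.ConvergesAt S x)
    (hsign : OrderedPowerSeries.value S a * OrderedPowerSeries.value S b < 0) :
    ∃ c ∈ Icc a b, OrderedPowerSeries.value S c = 0 ∧
      (∀ U ∈ 𝓝 c, ∀ᶠ n in atTop, (U ∩ OrderedPowerSeries.partialZeros S a b n).Nonempty) ∧
      ((¬ ∃ P : Polynomial K, (P : PowerSeries K) = S) →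
        AccPt c (𝓟 (⋃ n, OrderedPowerSeries.partialZeros S a b n))) ∧
      ∃ z : ℕ → K, (∀ᶠ n in atTop, z n ∈ OrderedPowerSeries.partialZeros S a b n) ∧
        Tendsto z atTop (𝓝 c) := by
  obtain ⟨c, hc, hval, hnear⟩ : ∃ c ∈ Icc a b, value S c = 0 ∧
      ∀ U ∈ 𝓝 c, ∀ᶠ n in atTop, (U ∩ partialZeros S a b n).Nonempty := by
    rcases mul_neg_iff.1 hsign with ⟨ha, hb⟩ | ⟨ha, hb⟩
    · obtain ⟨c, hc, hval, hnear⟩ := exists_zero_of_neg_of_pos (S := -S) hcount hab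
        (fun x hx => ⟨_, tendsto_eval_partialSum_neg (hconv x hx)⟩)
        (by rw [value_neg (hconv a (left_mem_Icc.2 hab.le))]; linarith)
        (by rw [value_neg (hconv b (right_mem_Icc.2 hab.le))]; linarith)
      rw [value_neg (hconv c hc), neg_eq_zero] at hval
      simp only [partialZeros_neg] at hnear
      exact ⟨c, hc, hval, hnear⟩
    · exact exists_zero_of_neg_of_pos hcount hab hconv ha hb
  exact ⟨c, hc, hval, hnear, accPt_iUnion_partialZeros hab hc hnear,
    exists_seq_partialZeros_tendsto hc hnear⟩
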